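/- Let $H$ be a complex Hilbert space, let $p>0$ be a real number, and let $T$ and $T_n$ ($n\in\mathbb N$) be bounded linear operators on $H$. Suppose that: 1. $T_n$ $\nu$-converges to $T$, i.e. $(\|T_n\|)$ is bounded, $\|(T_n-T)T\|\to 0$ and $\|(T_n-T)T_n\|\to 0$; 2. $T$ is a Fredholm operator (closed range, finite-dimensional kernel, range of finite codimension), and every $T_n$ is $p$-hyponormal, i.e. $(T_n^*T_n)^p-(T_nT_n^*)^p\ge 0$; 3. $0\in\sigma_p(T_n)$ for every $n$, i.e. $0$ is an eigenvalue of $T_n$; and, with $B_n=T_n|_{N(T_n)^\perp}\colon N(T_n)^\perp\to N(T_n)^\perp$ (the subspace $N(T_n)^\perp$ is invariant under the $p$-hyponormal operator $T_n$, so that $T_n=0\oplus B_n$ on $N(T_n)\oplus N(T_n)^\perp$) and $|B_n|=(B_n^*B_n)^{1/2}$, the norms $\||B_n|^{-1}\|$ are bounded, i.e. there is a constant $M$ with $\||B_n|^{-1}\|\le M$ for every $n$ for which $|B_n|$ is invertible. Then $\sigma(T_n)\to\sigma(T)$ in the Hausdorff metric on non-empty compact subsets of $\mathbb C$. -/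

import Mathlib

open Filter Topology
open scoped InnerProductSpace NNReal

/-- `ν`-convergence of a sequence `x n` to `a` in a normed algebra: the norms `‖x n‖` are bounded,
`‖(x n - a) a‖ → 0` and `‖(x n - a) (x n)‖ → 0`. -/
def NuConverges {A : Type*} [NormedRing A] (x : ℕ → A) (a : A) : Prop :=
  BddAbove (Set.range fun n => ‖x n‖) ∧
    Tendsto (fun n => ‖(x n - a) * a‖) atTop (𝓝 0) ∧
    Tendsto (fun n => ‖(x n - a) * x n‖) atTop (𝓝 0)

section Operators

variable {H : Type*} [NormedAddCommGroup H] [InnerProductSpace ℂ H] [CompleteSpace H]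

/-- `A` is `p`-hyponormal if `(A* A)^p - (A A*)^p ≥ 0`; the powers of the positive operators
`A* A` and `A A*` are those of the continuous functional calculus, and `≥` is the Loewner order. -/
def IsPHyponormal (p : ℝ) (A : H →L[ℂ] H) : Prop :=
  0 ≤ (star A * A) ^ p - (A * star A) ^ p

theorem sq_apply_eq_zero {b : H →L[ℂ] H} (hb : 0 ≤ b) {x : H} (h : (b * b) x = 0) : b x = 0 := by
  have hs : star b = b := (IsSelfAdjoint.of_nonneg hb)
  have h1 : ⟪b x, b x⟫_ℂ = 0 := by
    rw [← ContinuousLinearMap.adjoint_inner_right, ← ContinuousLinearMap.star_eq_adjoint, hs]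
    have : b (b x) = 0 := h
    rw [this, inner_zero_right]
  exact inner_self_eq_zero.1 h1

theorem nnrpow_half_apply_eq_zero {a : H →L[ℂ] H} {q : ℝ≥0} (hq : 0 < q) {x : H}
    (hx : (a ^ q) x = 0) : (a ^ (q / 2)) x = 0 := by
  have hq2 : 0 < q / 2 := half_pos hq
  have h := CFC.nnrpow_add (a := a) hq2 hq2
  rw [add_halves] at h
  have hb : 0 ≤ a ^ (q / 2) := CFC.nnrpow_nonneg
  generalize a ^ (q / 2) = b at h hb ⊢
  rw [h] at hx
  exact sq_apply_eq_zero hb hx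

theorem rpow_apply_eq_zero {a : H →L[ℂ] H} (ha : 0 ≤ a) {p : ℝ} (hp : 0 < p) {x : H}
    (hx : a x = 0) : (a ^ p) x = 0 := by
  have key : ∀ k : ℕ, ∃ q : ℝ≥0, 0 < q ∧ q ≤ (1 / 2) ^ k ∧ (a ^ q) x = 0 := by
    intro k
    induction k with
    | zero =>
      refine ⟨1, one_pos, by simp, ?_⟩
      rw [CFC.nnrpow_one a ha]
      exact hx
    | succ k ih =>
      obtain ⟨q, hq, hqk, hqx⟩ := ih
      refine ⟨q / 2, half_pos hq, ?_, nnrpow_half_apply_eq_zero hq hqx⟩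
      rw [pow_succ, div_eq_mul_one_div]
      exact mul_le_mul_left hqk _
  lift p to ℝ≥0 using hp.le
  have hp' : 0 < p := NNReal.coe_pos.1 hp
  have hhalf : (1 / 2 : ℝ≥0) < 1 := NNReal.half_lt_self one_ne_zero
  obtain ⟨k, hk⟩ := exists_pow_lt_of_lt_one hp' hhalf
  obtain ⟨q, hq, hqk, hqx⟩ := key k
  have hqp : q < p := hqk.trans_lt hk
  have h := CFC.nnrpow_add (a := a) (tsub_pos_of_lt hqp) hq
  rw [tsub_add_cancel_of_le hqp.le] at h
  rw [← CFC.nnrpow_eq_rpow hp', h]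
  show (a ^ (p - q)) ((a ^ q) x) = 0
  rw [hqx, map_zero]

open scoped ComplexOrder in
/-- For `p`-hyponormal `A`, `N(A) ⊆ N(A*)`. -/
theorem IsPHyponormal.star_apply_eq_zero {p : ℝ} (hp : 0 < p) {A : H →L[ℂ] H}
    (hA : IsPHyponormal p A) {x : H} (hx : A x = 0) : (star A) x = 0 := by
  have ha : 0 ≤ star A * A := star_mul_self_nonneg A
  have hc : 0 ≤ A * star A := mul_star_self_nonneg A
  have h1 : ((star A * A) ^ p) x = 0 := by
    apply rpow_apply_eq_zero ha hp
    show star A (A x) = 0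
    rw [hx, map_zero]
  set c := (A * star A) ^ p with hcdef
  have hc0 : 0 ≤ c := CFC.rpow_nonneg
  have h2 : c x = 0 := by
    have hpos := (ContinuousLinearMap.nonneg_iff_isPositive _).1 hA
    have h3 := hpos.inner_nonneg_left x
    have h4 := ((ContinuousLinearMap.nonneg_iff_isPositive _).1 hc0).inner_nonneg_left x
    rw [sub_apply, h1, zero_sub, inner_neg_left] at h3
    have h5 : ⟪c x, x⟫_ℂ = 0 := le_antisymm (neg_nonneg.1 h3) h4
    have hq : CFC.sqrt c * CFC.sqrt c = c := CFC.sqrt_mul_sqrt_self c hc0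
    have hs : star (CFC.sqrt c) = CFC.sqrt c := IsSelfAdjoint.of_nonneg (CFC.sqrt_nonneg c)
    have h6 : CFC.sqrt c x = 0 := by
      rw [← inner_self_eq_zero (𝕜 := ℂ), ← ContinuousLinearMap.adjoint_inner_left,
        ← ContinuousLinearMap.star_eq_adjoint, hs, ← h5]
      nth_rw 3 [← hq]
      rfl
    rw [← hq]
    show CFC.sqrt c (CFC.sqrt c x) = 0
    rw [h6, map_zero]
  have h7 : (A * star A) x = 0 := by
    have h8 := rpow_apply_eq_zero hc0 (inv_pos.2 hp) h2
    rwa [hcdef, CFC.rpow_rpow_of_exponent_nonneg _ _ _ hp.le (inv_pos.2 hp).le hc,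
      mul_inv_cancel₀ hp.ne', CFC.rpow_one _ hc] at h8
  rw [← inner_self_eq_zero (𝕜 := ℂ)]
  nth_rw 1 [ContinuousLinearMap.star_eq_adjoint]
  rw [ContinuousLinearMap.adjoint_inner_left]
  have : A (star A x) = 0 := h7
  rw [this, inner_zero_right]

/-- `N(A)ᗮ` is invariant under a `p`-hyponormal operator `A`. -/
theorem IsPHyponormal.mapsTo_orthogonal_ker {p : ℝ} (hp : 0 < p) {A : H →L[ℂ] H}
    (hA : IsPHyponormal p A) : Set.MapsTo A (A.ker)ᗮ (A.ker)ᗮ := by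
  intro x _
  rw [SetLike.mem_coe, Submodule.mem_orthogonal]
  intro y hy
  rw [← ContinuousLinearMap.adjoint_inner_left, ← ContinuousLinearMap.star_eq_adjoint,
    hA.star_apply_eq_zero hp hy, inner_zero_left]

/-- The restriction `B = A|_{N(A)ᗮ} : N(A)ᗮ → N(A)ᗮ` of a `p`-hyponormal operator `A`, so that
`A = 0 ⊕ B` on `H = N(A) ⊕ N(A)ᗮ`. -/
noncomputable def IsPHyponormal.orthKerPart {p : ℝ} (hp : 0 < p) {A : H →L[ℂ] H}
    (hA : IsPHyponormal p A) : (A.ker)ᗮ →L[ℂ] (A.ker)ᗮ :=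
  A.restrict (hA.mapsTo_orthogonal_ker hp)

/-- The modulus `|B| = (B* B)^(1/2)` of a bounded operator. -/
noncomputable def modulus (B : H →L[ℂ] H) : H →L[ℂ] H := CFC.abs B

end Operators

/-! ### Fractional powers and the Aluthge-type iteration -/

section CStar

variable {A : Type*} [CStarAlgebra A] [PartialOrder A] [StarOrderedRing A]

/-! Let `d = T_n - T`. If `l ≠ 0` and `r = (l - T)⁻¹`, then `r = l⁻¹(1 + T r)`, so `(r d)² = l⁻¹ r
(d T r d + d²)` is small although `d` need not be, and a small square already makes `1 ± r d`
invertible (`isUnit_one_add_of_norm_sq_lt`). With compactness this puts `σ(T_n)` eventually near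
`σ(T)`; the excluded point `0` lies in `σ(T)`. Exchanging `T` and `T_n` in the identity shows that
`l ≠ 0` is off `σ(T)` once `(l - T_n)⁻¹` exists with bounded norm for infinitely many `n`. What
remains is to bound the resolvent of `T_n` by the distance to `σ(T_n)`, uniformly in `n`
(`exists_resolvent_bound`).

For hyponormal operators the resolvent norm is at most the inverse distance. A `p`-hyponormal `b` is
brought to that case by the similarities `b ↦ |b|^p b |b|^(-p)` with `p = 2⁻ᵏ`, each doubling the
exponent; they are uniformly bounded if `b* b` is bounded below. A kernel obstructs this, so `A` is
replaced by `A - l E`, with `E` the projection onto `N(A)`: the eigenvalue `0` moves to `-l`, away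
from `l`. The lower bound comes from Fredholmness, which makes `|B_n|` eventually invertible, and
from the bound on the inverses. -/

theorem pow_mul_rpow_mul_star (b : A) (h : IsUnit (star b * b)) (s : ℝ) (n : ℕ) :
    (b * (star b * b) ^ (s - 1) * star b) ^ (n + 1) =
      b * (star b * b) ^ ((n + 1) * s - 1) * star b := by
  have h1 : (star b * b) ^ (1 : ℝ) = star b * b := CFC.rpow_one _ (star_mul_self_nonneg b)
  induction n with
  | zero => simp
  | succ n ih =>
    rw [pow_succ, ih]
    have e : ((n + 1 : ℕ) + 1 : ℝ) * s - 1 = ((n + 1) * s - 1) + (1 + (s - 1)) := by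
      push_cast; ring
    rw [e, CFC.rpow_add h, CFC.rpow_add h, h1]
    simp only [mul_assoc]

/-- Both sides are positive with the same `n`-th power. Exponents `1/n` suffice, since only the
powers `2⁻ᵏ` are iterated. -/
theorem mul_star_rpow_inv_nat (b : A) (h : IsUnit (star b * b)) {n : ℕ} (hn : n ≠ 0) :
    (b * star b) ^ ((n : ℝ)⁻¹) = b * (star b * b) ^ ((n : ℝ)⁻¹ - 1) * star b := by
  obtain ⟨m, rfl⟩ := Nat.exists_eq_succ_of_ne_zero hn
  have hpos : 0 ≤ b * (star b * b) ^ (((m + 1 : ℕ) : ℝ)⁻¹ - 1) * star b :=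
    star_right_conjugate_nonneg CFC.rpow_nonneg b
  have h1 := pow_mul_rpow_mul_star b h (((m + 1 : ℕ) : ℝ)⁻¹) m
  have hm : ((m : ℝ) + 1) ≠ 0 := by positivity
  have e : ((m : ℝ) + 1) * ((m + 1 : ℕ) : ℝ)⁻¹ - 1 = 0 := by
    push_cast; field_simp; ring
  rw [e, CFC.rpow_zero _ (star_mul_self_nonneg b), mul_one] at h1
  rw [Nat.succ_eq_add_one, ← h1, ← CFC.rpow_natCast _ _ hpos,
    CFC.rpow_rpow_of_exponent_nonneg _ _ _ (by positivity) (by positivity) hpos,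
    mul_inv_cancel₀ (by positivity), CFC.rpow_one _ hpos]

theorem rpow_le_rpow_of_nonpos {a b : A} (ha : IsStrictlyPositive a) (hab : a ≤ b) {s : ℝ}
    (hs : -1 ≤ s) (hs' : s ≤ 0) : b ^ s ≤ a ^ s := by
  have hb : IsStrictlyPositive b := ha.of_le hab
  have h := CStarAlgebra.rpow_neg_one_le_rpow_neg_one hab ha
  have h2 := CFC.rpow_le_rpow (p := -s) ⟨by linarith, by linarith⟩ h
  rwa [CFC.rpow_rpow _ _ _ (by norm_num) ha, CFC.rpow_rpow _ _ _ (by norm_num) hb,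
    neg_one_mul, neg_neg] at h2

/-- One step of the Aluthge-type transformation: it doubles the exponent of hyponormality. -/
theorem aluthge_step {n : ℕ} (hn : n ≠ 0) (b : A) (hQ : IsStrictlyPositive (star b * b))
    (hb : (b * star b) ^ (((2 * n : ℕ) : ℝ)⁻¹) ≤ (star b * b) ^ (((2 * n : ℕ) : ℝ)⁻¹))
    {c : A} (hc : c = (star b * b) ^ ((((2 * n : ℕ) : ℝ)⁻¹) / 2) * b *
      (star b * b) ^ (-((((2 * n : ℕ) : ℝ)⁻¹) / 2))) :
    star b * b ≤ star c * c ∧ (c * star c) ^ ((n : ℝ)⁻¹) ≤ (star c * c) ^ ((n : ℝ)⁻¹) := by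
  have hu := hQ.isUnit
  rw [mul_star_rpow_inv_nat b hu (by omega)] at hb
  set Q := star b * b with hQdef
  have hn1 : (1 : ℝ) ≤ n := by exact_mod_cast Nat.one_le_iff_ne_zero.2 hn
  have hninv : (n : ℝ)⁻¹ ≤ 1 := inv_le_one_of_one_le₀ hn1
  have hninv0 : 0 ≤ (n : ℝ)⁻¹ := by positivity
  set p : ℝ := ((2 * n : ℕ) : ℝ)⁻¹ with hp
  have hpn : (n : ℝ)⁻¹ = 2 * p := by rw [hp]; push_cast; field_simp
  rw [hpn] at hninv hninv0 ⊢
  have hsa : ∀ s : ℝ, star (Q ^ s) = Q ^ s := fun s => IsSelfAdjoint.of_nonneg CFC.rpow_nonneg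
  have hQ1 : Q ^ (1 : ℝ) = Q := CFC.rpow_one _ hQ.nonneg
  -- Substituting `(b b*)^p ≤ Q^p` in the middle of `c* c` leaves exactly `Q`, because `b* (b b*)^p
  -- b = Q^(1 + p)`.
  have key : Q ≤ star c * c := by
    have e1 : star c * c = Q ^ (-(p / 2)) * (star b * Q ^ p * b) * Q ^ (-(p / 2)) := by
      have e : Q ^ p = Q ^ (p / 2) * Q ^ (p / 2) := by rw [← CFC.rpow_add hu, add_halves]
      rw [hc, e]
      simp only [star_mul, hsa, mul_assoc]
    have e2 : Q = Q ^ (-(p / 2)) * (star b * (b * Q ^ (p - 1) * star b) * b) * Q ^ (-(p / 2)) := by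
      have e3 : star b * (b * Q ^ (p - 1) * star b) * b = Q ^ (1 + p) := by
        rw [show 1 + p = 1 + (p - 1) + 1 by ring, CFC.rpow_add hu, CFC.rpow_add hu, hQ1, hQdef]
        simp only [mul_assoc]
      rw [e3, ← CFC.rpow_add hu, ← CFC.rpow_add hu]
      ring_nf
      exact hQ1.symm
    rw [e1]
    nth_rw 1 [e2]
    have h1 := star_left_conjugate_le_conjugate (star_left_conjugate_le_conjugate hb b)
      (Q ^ (-(p / 2)))
    rwa [hsa] at h1
  refine ⟨key, ?_⟩
  have hcu : IsStrictlyPositive (star c * c) := hQ.of_le key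
  -- The exponent `2p - 1` lies in `[-1, 0]`, where powers reverse the order, so `Q ≤ c* c` can be
  -- used inside the conjugation by `c`.
  calc (c * star c) ^ (2 * p) = c * (star c * c) ^ (2 * p - 1) * star c := by
        rw [← hpn]; exact mul_star_rpow_inv_nat c hcu.isUnit hn
    _ ≤ c * Q ^ (2 * p - 1) * star c :=
        star_right_conjugate_le_conjugate
          (rpow_le_rpow_of_nonpos hQ key (by linarith) (by linarith)) c
    _ = Q ^ (p / 2) * (b * Q ^ (p - 1) * star b) * Q ^ (p / 2) := by
        have e : Q ^ (p - 1) = Q ^ (-(p / 2)) * Q ^ (2 * p - 1) * Q ^ (-(p / 2)) := by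
          rw [← CFC.rpow_add hu, ← CFC.rpow_add hu]; ring_nf
        rw [hc, e]
        simp only [star_mul, hsa, mul_assoc]
    _ ≤ Q ^ (p / 2) * Q ^ p * Q ^ (p / 2) := by
        have h1 := star_left_conjugate_le_conjugate hb (Q ^ (p / 2))
        rwa [hsa] at h1
    _ = Q ^ (2 * p) := by
        rw [← CFC.rpow_add hu, ← CFC.rpow_add hu]; ring_nf
    _ ≤ (star c * c) ^ (2 * p) := CFC.rpow_le_rpow ⟨hninv0, hninv⟩ key

theorem norm_rpow_le {a : A} (ha : 0 ≤ a) {s K : ℝ} (hs : 0 ≤ s) (hs' : s ≤ 1) (hK : 1 ≤ K)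
    (h : ‖a‖ ≤ K) : ‖a ^ s‖ ≤ K := by
  have h1 : a ≤ algebraMap ℝ A K :=
    (CStarAlgebra.norm_le_iff_le_algebraMap a (by linarith) ha).1 h
  have h2 := CFC.rpow_le_rpow (p := s) ⟨hs, hs'⟩ h1
  have e : (algebraMap ℝ A K) ^ s = algebraMap ℝ A (K ^ s) := by
    lift K to ℝ≥0 using by linarith
    exact CFC.rpow_algebraMap
  rw [e] at h2
  have hKs : 0 ≤ K ^ s := Real.rpow_nonneg (by linarith) s
  refine ((CStarAlgebra.norm_le_iff_le_algebraMap _ hKs CFC.rpow_nonneg).2 h2).trans ?_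
  calc K ^ s ≤ K ^ (1 : ℝ) := Real.rpow_le_rpow_of_exponent_le hK hs'
    _ = K := Real.rpow_one K

/-- A bounded family of invertible-modulus `2⁻ᵏ`-hyponormal elements is uniformly similar to
hyponormal elements. -/
theorem exists_similar_hyponormal (k : ℕ) : ∀ K L : ℝ, 1 ≤ K → 1 ≤ L → ∃ D : ℝ, ∀ b : A,
    ‖b‖ ≤ K → IsStrictlyPositive (star b * b) → ‖(star b * b) ^ (-1 : ℝ)‖ ≤ L →
    (b * star b) ^ (((2 ^ k : ℕ) : ℝ)⁻¹) ≤ (star b * b) ^ (((2 ^ k : ℕ) : ℝ)⁻¹) →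
    ∃ s t c : A, s * t = 1 ∧ t * s = 1 ∧ ‖s‖ ≤ D ∧ ‖t‖ ≤ D ∧ b = t * c * s ∧
      c * star c ≤ star c * c := by
  induction k with
  | zero =>
    intro K L _ _
    refine ⟨‖(1 : A)‖, fun b _ hQ _ hb => ⟨1, 1, b, by simp, by simp, le_rfl, le_rfl, by simp, ?_⟩⟩
    simpa [CFC.rpow_one _ (star_mul_self_nonneg b), CFC.rpow_one _ (mul_star_self_nonneg b)] using hb
  | succ k ih =>
    intro K L hK hL
    have hKK : 1 ≤ K * K := one_le_mul_of_one_le_of_one_le hK hK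
    -- The transform has norm at most `K² · K · L`, while `L` persists because `c* c ≥ b* b`.
    obtain ⟨D, hD⟩ := ih ((K * K) * K * L)
      L (one_le_mul_of_one_le_of_one_le (one_le_mul_of_one_le_of_one_le hKK hK) hL) hL
    -- The sum dominates the bounds for both similarity factors; `max 0 D` is needed because `D` may
    -- be negative when no element qualifies.
    refine ⟨max 0 D * (K * K) + max 0 D * L, fun b hbK hQ hbL hb => ?_⟩
    rw [pow_succ'] at hb
    obtain ⟨h1, h2⟩ := aluthge_step (by positivity) b hQ hb rfl
    set p : ℝ := ((2 * 2 ^ k : ℕ) : ℝ)⁻¹ with hp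
    have hp0 : 0 ≤ p / 2 := by positivity
    have hp1 : p / 2 ≤ 1 := by
      have : p ≤ 1 := inv_le_one_of_one_le₀ (by exact_mod_cast Nat.one_le_iff_ne_zero.2 (by positivity))
      linarith
    set Q := star b * b with hQdef
    have hS : ‖Q ^ (p / 2)‖ ≤ K * K := by
      refine norm_rpow_le hQ.nonneg hp0 hp1 hKK ?_
      rw [hQdef, CStarRing.norm_star_mul_self]
      exact mul_le_mul hbK hbK (norm_nonneg _) (by linarith)
    have hT : ‖Q ^ (-(p / 2))‖ ≤ L := by
      have e : Q ^ (-(p / 2)) = (Q ^ (-1 : ℝ)) ^ (p / 2) := by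
        rw [CFC.rpow_rpow _ _ _ (by norm_num) hQ, neg_one_mul]
      rw [e]
      exact norm_rpow_le CFC.rpow_nonneg hp0 hp1 hL hbL
    have hst : Q ^ (p / 2) * Q ^ (-(p / 2)) = 1 := CFC.rpow_mul_rpow_neg _ hQ
    have hts : Q ^ (-(p / 2)) * Q ^ (p / 2) = 1 := CFC.rpow_neg_mul_rpow _ hQ
    have hcb : b = Q ^ (-(p / 2)) * (Q ^ (p / 2) * b * Q ^ (-(p / 2))) * Q ^ (p / 2) := by
      simp only [mul_assoc, hts, mul_one]
      simp only [← mul_assoc, hts, one_mul]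
    set c := Q ^ (p / 2) * b * Q ^ (-(p / 2)) with hc
    have hcQ : IsStrictlyPositive (star c * c) := hQ.of_le h1
    have hcK : ‖c‖ ≤ K * K * K * L := by
      refine (norm_mul_le _ _).trans (mul_le_mul ((norm_mul_le _ _).trans
        (mul_le_mul hS hbK (norm_nonneg _) (by linarith))) hT (norm_nonneg _) (by positivity))
    have hcL : ‖(star c * c) ^ (-1 : ℝ)‖ ≤ L :=
      (CStarAlgebra.norm_le_norm_of_nonneg_of_le CFC.rpow_nonneg
        (CStarAlgebra.rpow_neg_one_le_rpow_neg_one h1 hQ)).trans hbL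
    obtain ⟨s, t, d, hst', hts', hs, ht, hd, hdh⟩ := hD c hcK hcQ hcL h2
    refine ⟨s * Q ^ (p / 2), Q ^ (-(p / 2)) * t, d, ?_, ?_, ?_, ?_, ?_, hdh⟩
    · rw [mul_assoc, ← mul_assoc (Q ^ (p / 2)), hst, one_mul, hst']
    · rw [mul_assoc, ← mul_assoc t, hts', one_mul, hts]
    · have := (norm_mul_le s (Q ^ (p / 2))).trans
        (mul_le_mul (hs.trans (le_max_right 0 D)) hS (norm_nonneg _) (le_max_left _ _))
      have : 0 ≤ max 0 D * L := mul_nonneg (le_max_left _ _) (by linarith)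
      linarith
    · have := (norm_mul_le (Q ^ (-(p / 2))) t).trans
        (mul_le_mul hT (ht.trans (le_max_right 0 D)) (norm_nonneg _) (by linarith))
      have : 0 ≤ max 0 D * (K * K) := mul_nonneg (le_max_left _ _) (by linarith)
      linarith
    · rw [hcb, hd]; simp only [mul_assoc]

end CStar

/-! ### Paranormality and the resolvent of a hyponormal operator -/

section Paranormal

/-- In a complex Banach algebra, `‖a ^ n‖ = ‖a‖ ^ n` for all `n` forces the spectral radius to
be the norm, so a bound for the spectrum is a bound for the norm. -/
theorem norm_le_of_spectrum_of_norm_pow {A : Type*} [NormedRing A] [NormedAlgebra ℂ A]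
    [CompleteSpace A] {a : A} (ha : ∀ n : ℕ, ‖a ^ (n + 1)‖ = ‖a‖ ^ (n + 1)) {r : ℝ} (hr : 0 ≤ r)
    (h : ∀ z ∈ spectrum ℂ a, ‖z‖ ≤ r) : ‖a‖ ≤ r := by
  have h1 : spectralRadius ℂ a ≤ ENNReal.ofReal r := by
    refine iSup₂_le fun z hz => ?_
    rw [← ENNReal.ofReal_coe_nnreal]
    exact ENNReal.ofReal_le_ofReal (h z hz)
  have h2 := spectrum.pow_norm_pow_one_div_tendsto_nhds_spectralRadius a
  have h3 : Tendsto (fun n : ℕ => ENNReal.ofReal (‖a ^ n‖ ^ (1 / n : ℝ))) atTop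
      (𝓝 (ENNReal.ofReal ‖a‖)) := by
    refine tendsto_const_nhds.congr' ?_
    filter_upwards [eventually_gt_atTop 0] with n hn
    obtain ⟨m, rfl⟩ := Nat.exists_eq_succ_of_ne_zero hn.ne'
    rw [Nat.succ_eq_add_one, ha m, one_div, Real.pow_rpow_inv_natCast (norm_nonneg a) (by omega)]
  rw [← tendsto_nhds_unique h3 h2] at h1
  exact (ENNReal.ofReal_le_ofReal_iff hr).1 h1

variable {H : Type*} [NormedAddCommGroup H] [InnerProductSpace ℂ H]

/-- A paranormal operator satisfies `‖Dⁿ‖ = ‖D‖ⁿ`. -/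
theorem norm_pow_of_paranormal {D : H →L[ℂ] H} (hD : ∀ x, ‖D x‖ ^ 2 ≤ ‖D (D x)‖ * ‖x‖) (n : ℕ) :
    ‖D ^ (n + 1)‖ = ‖D‖ ^ (n + 1) := by
  -- The norms of the powers are log-convex, so their successive ratios do not decrease; the first
  -- ratio is at least `‖D‖`.
  have hstep : ∀ n : ℕ, ‖D ^ (n + 1)‖ ^ 2 ≤ ‖D ^ (n + 2)‖ * ‖D ^ n‖ := by
    intro n
    rw [← Real.le_sqrt (norm_nonneg _) (by positivity)]
    refine ContinuousLinearMap.opNorm_le_bound _ (Real.sqrt_nonneg _) fun x => ?_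
    have h1 := hD ((D ^ n) x)
    have e1 : (D ^ (n + 1)) x = D ((D ^ n) x) := by rw [pow_succ']; rfl
    have e2 : (D ^ (n + 2)) x = D (D ((D ^ n) x)) := by rw [pow_succ', pow_succ']; rfl
    rw [← e2, ← e1] at h1
    have h2 := (D ^ (n + 2)).le_opNorm x
    have h3 := (D ^ n).le_opNorm x
    have h4 : ‖(D ^ (n + 1)) x‖ ^ 2 ≤ (‖D ^ (n + 2)‖ * ‖D ^ n‖) * ‖x‖ ^ 2 := by
      calc _ ≤ (‖D ^ (n + 2)‖ * ‖x‖) * (‖D ^ n‖ * ‖x‖) :=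
            h1.trans (mul_le_mul h2 h3 (norm_nonneg _) (by positivity))
        _ = _ := by ring
    rw [← Real.sqrt_sq (norm_nonneg x), ← Real.sqrt_mul (by positivity)]
    exact Real.le_sqrt_of_sq_le h4
  rcases (norm_nonneg D).eq_or_lt with h0 | h0
  · rw [norm_eq_zero.1 h0.symm]; simp
  have hratio : ∀ n : ℕ, ‖D‖ * ‖D ^ n‖ ≤ ‖D ^ (n + 1)‖ := by
    intro n
    induction n with
    | zero =>
      have h1 := hstep 0
      simp only [zero_add, pow_one, pow_zero] at h1 ⊢
      have h2 : ‖(1 : H →L[ℂ] H)‖ ≤ 1 := ContinuousLinearMap.norm_id_le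
      nlinarith
    | succ n ih =>
      have h1 := hstep n
      rcases (norm_nonneg (D ^ (n + 1))).eq_or_lt with h2 | h2
      · rw [← h2, mul_zero]; exact norm_nonneg _
      · have h3 : 0 < ‖D ^ n‖ := by
          rcases (norm_nonneg (D ^ n)).eq_or_lt with h3 | h3
          · rw [← h3, mul_zero] at h1
            nlinarith
          · exact h3
        have h4 : ‖D‖ * ‖D ^ (n + 1)‖ * ‖D ^ n‖ ≤ ‖D ^ (n + 2)‖ * ‖D ^ n‖ := by nlinarith
        exact le_of_mul_le_mul_right h4 h3
  refine le_antisymm (norm_pow_le' D (Nat.succ_pos n)) ?_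
  induction n with
  | zero => simp
  | succ n ih =>
    calc ‖D‖ ^ (n + 1 + 1) = ‖D‖ * ‖D‖ ^ (n + 1) := pow_succ' _ _
      _ ≤ ‖D‖ * ‖D ^ (n + 1)‖ := by gcongr
      _ ≤ _ := hratio (n + 1)

/-- Hyponormal operators are paranormal. -/
theorem paranormal_of_hyponormal [CompleteSpace H] {C : H →L[ℂ] H} (hC : C * star C ≤ star C * C) (x : H) :
    ‖C x‖ ^ 2 ≤ ‖C (C x)‖ * ‖x‖ := by
  have h1 : ∀ y, ‖star C y‖ ≤ ‖C y‖ := by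
    intro y
    have h2 := ((ContinuousLinearMap.le_def _ _).1 hC).re_inner_nonneg_left y
    rw [sub_apply, inner_sub_left, map_sub] at h2
    have e1 : ⟪(C * star C) y, y⟫_ℂ = ⟪star C y, star C y⟫_ℂ := by
      rw [ContinuousLinearMap.star_eq_adjoint, ContinuousLinearMap.adjoint_inner_right]; rfl
    have e2 : ⟪(star C * C) y, y⟫_ℂ = ⟪C y, C y⟫_ℂ := by
      rw [← ContinuousLinearMap.adjoint_inner_left, ContinuousLinearMap.star_eq_adjoint]; rfl
    rw [e1, e2, inner_self_eq_norm_sq, inner_self_eq_norm_sq] at h2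
    exact le_of_sq_le_sq (by linarith) (norm_nonneg _)
  have e : ⟪star C (C x), x⟫_ℂ = ⟪C x, C x⟫_ℂ := by
    rw [ContinuousLinearMap.star_eq_adjoint, ContinuousLinearMap.adjoint_inner_left]
  calc ‖C x‖ ^ 2 = RCLike.re ⟪C x, C x⟫_ℂ := (inner_self_eq_norm_sq (𝕜 := ℂ) _).symm
    _ = RCLike.re ⟪star C (C x), x⟫_ℂ := by rw [e]
    _ ≤ ‖star C (C x)‖ * ‖x‖ := re_inner_le_norm _ _
    _ ≤ _ := by gcongr; exact h1 _

/-- The resolvent of a hyponormal operator is bounded by the inverse distance to the spectrum. -/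
theorem norm_resolvent_le_of_hyponormal [CompleteSpace H] {C : H →L[ℂ] H} (hC : C * star C ≤ star C * C) {μ : ℂ}
    {ε : ℝ} (hε : 0 < ε) (h : ∀ z ∈ spectrum ℂ C, ε ≤ dist z μ) :
    ∃ D : H →L[ℂ] H, D * (algebraMap ℂ _ μ - C) = 1 ∧ (algebraMap ℂ _ μ - C) * D = 1 ∧
      ‖D‖ ≤ ε⁻¹ := by
  have hμ : μ ∉ spectrum ℂ C := fun hμ => by
    have := h μ hμ
    rw [dist_self] at this
    linarith
  obtain ⟨u, hu⟩ := spectrum.notMem_iff.1 hμ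
  -- Scalars drop out of the self-commutator, so `μ - C` is again hyponormal.
  have hhyp : (u : H →L[ℂ] H) * star (u : H →L[ℂ] H) ≤ star (u : H →L[ℂ] H) * u := by
    rw [← sub_nonneg] at hC ⊢
    convert hC using 1
    rw [hu, star_sub, ← algebraMap_star_comm]
    have c1 := Algebra.commutes μ (star C)
    have c2 := Algebra.commutes (star μ) C
    have c3 := Algebra.commutes μ (algebraMap ℂ (H →L[ℂ] H) (star μ))
    simp only [mul_sub, sub_mul, c1, c2, c3]
    abel
  refine ⟨↑u⁻¹, by rw [← hu]; exact u.inv_mul, by rw [← hu]; exact u.mul_inv, ?_⟩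
  refine norm_le_of_spectrum_of_norm_pow (norm_pow_of_paranormal fun x => ?_) (by positivity) ?_
  -- Paranormality of `u` at `u⁻² x` is paranormality of `u⁻¹` at `x`.
  · have hz := paranormal_of_hyponormal hhyp ((↑u⁻¹ : H →L[ℂ] H) ((↑u⁻¹ : H →L[ℂ] H) x))
    have e : ∀ y, (u : H →L[ℂ] H) ((↑u⁻¹ : H →L[ℂ] H) y) = y := fun y => by
      exact congrArg (fun f : H →L[ℂ] H => f y) u.mul_inv
    rw [e, e, mul_comm] at hz
    exact hz
  · intro z hz
    have hz0 : z ≠ 0 := by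
      rintro rfl
      exact (spectrum.zero_notMem_iff ℂ).2 (u⁻¹).isUnit hz
    lift z to ℂˣ using hz0.isUnit
    have h1 : ((z⁻¹ : ℂˣ) : ℂ) ∈ spectrum ℂ (u : H →L[ℂ] H) := by
      rw [spectrum.inv_mem_iff] at hz
      simpa using hz
    rw [hu] at h1
    have h2 : μ - ((z⁻¹ : ℂˣ) : ℂ) ∈ spectrum ℂ C := by
      rw [spectrum.mem_iff] at h1 ⊢
      contrapose! h1
      rw [← IsUnit.neg_iff]
      convert h1 using 1
      rw [map_sub]; abel
    have h3 := h _ h2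
    rw [dist_eq_norm, sub_sub_cancel_left, norm_neg, Units.val_inv_eq_inv_val, norm_inv] at h3
    exact (le_inv_comm₀ hε (by simp)).1 h3

end Paranormal

/-! ### Spectra under `ν`-convergence -/

section Perturbation

section NormedRing

variable {A : Type*} [NormedRing A] {x : ℕ → A} {a : A}

/-- Since `(1 + x)(1 - x) = 1 - x²` with commuting factors, only the square must be small;
`ν`-convergence controls no more than that. -/
theorem isUnit_one_add_of_norm_sq_lt [CompleteSpace A] {x : A} (h : ‖x * x‖ < 1) : IsUnit (1 + x) := by
  have h1 : IsUnit (1 - x * x) := (Units.oneSub _ h).isUnit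
  have e1 : (1 + x) * (1 - x) = 1 - x * x := by noncomm_ring
  have e2 : (1 - x) * (1 + x) = 1 - x * x := by noncomm_ring
  obtain ⟨u, hu⟩ := h1
  have h3 : (1 + x) * ((1 - x) * ↑u⁻¹) = 1 := by rw [← mul_assoc, e1, ← hu, u.mul_inv]
  have h4 : (↑u⁻¹ * (1 - x)) * (1 + x) = 1 := by rw [mul_assoc, e2, ← hu, u.inv_mul]
  exact isUnit_iff_exists_and_exists.2 ⟨⟨_, h3⟩, ⟨_, h4⟩⟩

/-- If `r` inverts `a` and `(r d)²` is small, then `a + d` is invertible. -/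
theorem isUnit_add_of_norm_sq_lt [CompleteSpace A] {a r d : A} (h1 : r * a = 1) (h2 : a * r = 1)
    (h : ‖(r * d) * (r * d)‖ < 1) : IsUnit (a + d) := by
  have e : a + d = a * (1 + r * d) := by rw [mul_add, mul_one, ← mul_assoc, h2, one_mul]
  rw [e]
  exact (isUnit_iff_exists_and_exists.2 ⟨⟨r, h2⟩, ⟨r, h1⟩⟩).mul (isUnit_one_add_of_norm_sq_lt h)

theorem NuConverges.exists_bound (h : NuConverges x a) :
    ∃ K : ℝ, 1 ≤ K ∧ (∀ n, ‖x n‖ ≤ K) ∧ ∀ n, ‖x n - a‖ ≤ K := by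
  obtain ⟨K, hK⟩ := h.1
  have hK' : ∀ n, ‖x n‖ ≤ K := fun n => hK ⟨n, rfl⟩
  refine ⟨max 1 (K + ‖a‖), le_max_left _ _, fun n => ?_, fun n => ?_⟩
  · exact ((hK' n).trans (by linarith [norm_nonneg a])).trans (le_max_right _ _)
  · exact ((norm_sub_le _ _).trans (by linarith [hK' n])).trans (le_max_right _ _)

theorem NuConverges.tendsto_sub_mul_sub (h : NuConverges x a) :
    Tendsto (fun n => ‖(x n - a) * (x n - a)‖) atTop (𝓝 0) := by
  refine squeeze_zero (fun _ => norm_nonneg _) (fun n => ?_)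
    (by simpa using h.2.2.add h.2.1)
  rw [mul_sub (x n - a)]
  exact norm_sub_le _ _

end NormedRing

variable {A : Type*} [NormedRing A] [NormedAlgebra ℂ A] {x : ℕ → A} {a : A}

/-- If `r = (l - a)⁻¹`, then `(r d)²` is controlled by `d a` and `d d`. -/
theorem norm_resolvent_mul_sq_le {a r d : A} {l : ℂ} (hl : l ≠ 0)
    (h2 : (algebraMap ℂ A l - a) * r = 1) :
    ‖(r * d) * (r * d)‖ ≤ ‖l‖⁻¹ * ‖r‖ * (‖d * a‖ * ‖r‖ * ‖d‖ + ‖d * d‖) := by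
  -- This places a factor `a` directly after the first `d`, where `d a` is small; `l ≠ 0` is
  -- essential.
  have e0 : r = l⁻¹ • (1 + a * r) := by
    rw [sub_mul, sub_eq_iff_eq_add, ← Algebra.smul_def] at h2
    rw [← h2, smul_smul, inv_mul_cancel₀ hl, one_smul]
  have e1 : (r * d) * (r * d) = l⁻¹ • (r * ((d * a) * r * d + d * d)) := by
    calc (r * d) * (r * d) = r * d * (r * d) := rfl
      _ = r * d * (l⁻¹ • (1 + a * r) * d) := by rw [← e0]
      _ = _ := by
        rw [smul_mul_assoc, mul_smul_comm]
        congr 1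
        noncomm_ring
  rw [e1, norm_smul, norm_inv, mul_assoc ‖l‖⁻¹]
  refine mul_le_mul_of_nonneg_left ((norm_mul_le _ _).trans ?_) (by positivity)
  gcongr
  refine (norm_add_le _ _).trans ?_
  gcongr
  exact (norm_mul_le _ _).trans (by gcongr; exact norm_mul_le _ _)

/-- Points off the spectrum of a `ν`-limit are, locally uniformly, eventually off the spectra. -/
theorem NuConverges.eventually_notMem_spectrum [CompleteSpace A] (h : NuConverges x a) {l : ℂ} (hl : l ≠ 0)
    (hla : l ∉ spectrum ℂ a) :
    ∀ᶠ q : ℕ × ℂ in atTop ×ˢ 𝓝 l, q.2 ∉ spectrum ℂ (x q.1) := by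
  obtain ⟨K, hK1, -, hK⟩ := h.exists_bound
  obtain ⟨u, hu⟩ := spectrum.notMem_iff.1 hla
  set r : A := ↑u⁻¹ with hr
  have hr1 : r * (algebraMap ℂ A l - a) = 1 := by rw [← hu]; exact u.inv_mul
  have hr2 : (algebraMap ℂ A l - a) * r = 1 := by rw [← hu]; exact u.mul_inv
  -- The majorant comes from expanding `(r d + m r)²` with `m = μ - l`: the first summand bounds `(r
  -- d)²`, and the others carry a factor `‖m‖`.
  have hlim : Tendsto (fun q : ℕ × ℂ => ‖l‖⁻¹ * ‖r‖ * (‖(a - x q.1) * a‖ * ‖r‖ * K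
      + ‖(a - x q.1) * (a - x q.1)‖) + ‖r‖ * K * ‖r‖ * ‖q.2 - l‖ + ‖q.2 - l‖ * ‖r‖ * (‖r‖ * K)
      + (‖q.2 - l‖ * ‖r‖) * (‖q.2 - l‖ * ‖r‖)) (atTop ×ˢ 𝓝 l) (𝓝 0) := by
    have t1 : Tendsto (fun q : ℕ × ℂ => ‖(a - x q.1) * a‖) (atTop ×ˢ 𝓝 l) (𝓝 0) := by
      refine (h.2.1.comp tendsto_fst).congr fun q => ?_
      simp only [Function.comp]
      rw [← norm_neg, ← neg_mul, neg_sub]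
    have t2 : Tendsto (fun q : ℕ × ℂ => ‖(a - x q.1) * (a - x q.1)‖) (atTop ×ˢ 𝓝 l) (𝓝 0) := by
      refine (h.tendsto_sub_mul_sub.comp tendsto_fst).congr fun q => ?_
      simp only [Function.comp]
      rw [← neg_sub a, neg_mul_neg]
    have t3 : Tendsto (fun q : ℕ × ℂ => ‖q.2 - l‖) (atTop ×ˢ 𝓝 l) (𝓝 0) := by
      have : Tendsto (fun q : ℕ × ℂ => q.2 - l) (atTop ×ˢ 𝓝 l) (𝓝 (l - l)) :=
        tendsto_snd.sub_const l
      simpa using this.norm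
    have := ((((((t1.mul_const ‖r‖).mul_const K).add t2).const_mul (‖l‖⁻¹ * ‖r‖)).add
      (t3.const_mul (‖r‖ * K * ‖r‖))).add ((t3.mul_const ‖r‖).mul_const (‖r‖ * K))).add
      ((t3.mul_const ‖r‖).mul (t3.mul_const ‖r‖))
    simpa using this
  filter_upwards [hlim.eventually_lt_const one_pos] with ⟨n, μ⟩ hq
  simp only at hq
  rw [spectrum.notMem_iff]
  have e : algebraMap ℂ A μ - x n =
      (algebraMap ℂ A l - a) + ((a - x n) + algebraMap ℂ A (μ - l)) := by
    rw [map_sub]; abel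
  rw [e]
  refine isUnit_add_of_norm_sq_lt hr1 hr2 (lt_of_le_of_lt ?_ hq)
  have hd : ‖a - x n‖ ≤ K := by rw [norm_sub_rev]; exact hK n
  have h1 := norm_resolvent_mul_sq_le (d := a - x n) hl hr2
  set d := a - x n
  set m := μ - l
  have e2 : r * (d + algebraMap ℂ A m) = r * d + m • r := by
    rw [mul_add, ← Algebra.commutes, ← Algebra.smul_def]
  rw [e2]
  have e3 : (r * d + m • r) * (r * d + m • r) =
      (r * d) * (r * d) + (r * d) * (m • r) + (m • r) * (r * d) + (m • r) * (m • r) := by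
    rw [add_mul, mul_add, mul_add]; abel
  have hrd : ‖r * d‖ ≤ ‖r‖ * K := (norm_mul_le _ _).trans (by gcongr)
  rw [e3]
  refine (norm_add_le _ _).trans (add_le_add ((norm_add_le _ _).trans (add_le_add
    ((norm_add_le _ _).trans (add_le_add (h1.trans ?_) ?_)) ?_)) ?_)
  · gcongr
  · refine (norm_mul_le _ _).trans ?_
    rw [norm_smul]
    calc ‖r * d‖ * (‖m‖ * ‖r‖) ≤ (‖r‖ * K) * (‖m‖ * ‖r‖) := by gcongr
      _ = _ := by ring
  · refine (norm_mul_le _ _).trans ?_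
    rw [norm_smul]
    gcongr
  · refine (norm_mul_le _ _).trans ?_
    rw [norm_smul]

/-- A point at which the resolvents of `x n` exist and are bounded along infinitely many `n` is
not in the spectrum of the `ν`-limit. -/
theorem NuConverges.notMem_spectrum_of_frequently [CompleteSpace A] (h : NuConverges x a) {l : ℂ} (hl : l ≠ 0)
    {M : ℝ} (hM : ∃ᶠ n in atTop, ∃ r : A, r * (algebraMap ℂ A l - x n) = 1 ∧
      (algebraMap ℂ A l - x n) * r = 1 ∧ ‖r‖ ≤ M) : l ∉ spectrum ℂ a := by
  obtain ⟨K, hK1, -, hK⟩ := h.exists_bound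
  have hlim : Tendsto (fun n => ‖l‖⁻¹ * M * (‖(x n - a) * x n‖ * M * K
      + ‖(x n - a) * (x n - a)‖)) atTop (𝓝 0) := by
    simpa using (((h.2.2.mul_const M).mul_const K).add h.tendsto_sub_mul_sub).const_mul (‖l‖⁻¹ * M)
  obtain ⟨n, ⟨r, hr1, hr2, hrM⟩, hn⟩ := (hM.and_eventually (hlim.eventually_lt_const one_pos)).exists
  have hM0 : 0 ≤ M := (norm_nonneg _).trans hrM
  rw [spectrum.notMem_iff]
  -- Here `a` is the perturbation of `x n`, so the product `(x n - a) * x n` is the one that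
  -- matters.
  have e : algebraMap ℂ A l - a = (algebraMap ℂ A l - x n) + (x n - a) := by abel
  rw [e]
  refine isUnit_add_of_norm_sq_lt hr1 hr2 (lt_of_le_of_lt ?_ hn)
  refine (norm_resolvent_mul_sq_le hl hr2).trans ?_
  gcongr
  exact hK n

/-- Upper semicontinuity of the spectrum under `ν`-convergence, when `0 ∈ σ(a)`. -/
theorem NuConverges.eventually_spectrum_near [CompleteSpace A] (h : NuConverges x a) (h0 : (0 : ℂ) ∈ spectrum ℂ a)
    {ε : ℝ} (hε : 0 < ε) :
    ∀ᶠ n in atTop, ∀ μ ∈ spectrum ℂ (x n), ∃ l ∈ spectrum ℂ a, dist μ l < ε := by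
  obtain ⟨K, hK1, hK, -⟩ := h.exists_bound
  set R := K * ‖(1 : A)‖
  have hc : IsCompact (Metric.closedBall (0 : ℂ) R \ Metric.thickening ε (spectrum ℂ a)) :=
    (isCompact_closedBall 0 R).diff Metric.isOpen_thickening
  have hev : ∀ᶠ n in atTop, ∀ μ ∈ Metric.closedBall (0 : ℂ) R \ Metric.thickening ε (spectrum ℂ a),
      μ ∉ spectrum ℂ (x n) := by
    have hmem : {q : ℕ × ℂ | q.2 ∉ spectrum ℂ (x q.1)} ∈ (atTop : Filter ℕ) ×ˢ
        𝓝ˢ (Metric.closedBall (0 : ℂ) R \ Metric.thickening ε (spectrum ℂ a)) := by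
      refine hc.mem_prod_nhdsSet_of_forall fun l hl => ?_
      have hla : l ∉ spectrum ℂ a := fun hla => hl.2 (Metric.self_subset_thickening hε _ hla)
      exact h.eventually_notMem_spectrum (fun hl0 => hla (hl0 ▸ h0)) hla
    exact (Filter.Eventually.curry hmem).mono fun n hn => hn.self_of_nhdsSet
  filter_upwards [hev] with n hn μ hμ
  by_contra hcon
  refine hn μ ⟨?_, fun hth => hcon ?_⟩ hμ
  · rw [mem_closedBall_zero_iff]
    exact (spectrum.norm_le_norm_mul_of_mem hμ).trans (mul_le_mul_of_nonneg_right (hK n) (norm_nonneg _))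
  · exact Metric.mem_thickening_iff.1 hth

end Perturbation

/-! ### Finite codimension and uniform lower bounds -/

section Fredholm

variable {H : Type*} [NormedAddCommGroup H] [InnerProductSpace ℂ H] [CompleteSpace H]

/-- If `T` is Fredholm and `‖(x n - T) T‖ → 0`, then eventually the range of `x n` has finite
codimension. -/
theorem eventually_coFG_range {T : H →L[ℂ] H} (hT : T.IsFredholm) {x : ℕ → H →L[ℂ] H}
    (h : Tendsto (fun n => ‖(x n - T) * T‖) atTop (𝓝 0)) :
    ∀ᶠ n in atTop, (x n).range.CoFG := by
  obtain ⟨v, hv⟩ := hT.exists_isQuasiInverse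
  have hvv := (hv.comp hv).2
  set F : H →ₗ[ℂ] H := ((T : H →ₗ[ℂ] H) ∘ₗ T) ∘ₗ ((v : H →ₗ[ℂ] H) ∘ₗ v) - LinearMap.id with hF
  have hfin : F.HasFiniteRange := LinearMap.FiniteRangeSetoid.equiv_iff_hasFiniteRange.1 hvv
  have hlim := h.mul_const ‖v * v‖
  rw [zero_mul] at hlim
  filter_upwards [hlim.eventually_lt_const one_pos] with n hn
  -- With `v` a quasi-inverse of `T`, `x n * T * v² = 1 + F + G`, where `F` has finite rank and `1 +
  -- G` is invertible. Hence modulo the range of `x n` every vector lies in the range of `F`.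
  set G := (x n - T) * T * (v * v) with hG
  have hGn : ‖-G‖ < 1 := by rw [norm_neg]; exact (norm_mul_le _ _).trans_lt hn
  have hW : IsUnit (1 + G) := by
    have := (Units.oneSub (-G) hGn).isUnit
    rwa [Units.val_oneSub, sub_neg_eq_add] at this
  have hsurj := (ContinuousLinearMap.isUnit_iff_bijective.1 hW).2
  have hfd : Module.Finite ℂ F.range := Module.Finite.iff_fg.2 hfin.fg_range
  refine Module.Finite.of_surjective ((x n).range.mkQ ∘ₗ F.range.subtype) fun q => ?_
  obtain ⟨y, rfl⟩ := (x n).range.mkQ_surjective q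
  obtain ⟨z, hz⟩ := hsurj y
  refine ⟨⟨F (-z), ⟨-z, rfl⟩⟩, ?_⟩
  rw [LinearMap.comp_apply, Submodule.subtype_apply, ← sub_eq_zero, ← map_sub,
    Submodule.mkQ_apply, Submodule.Quotient.mk_eq_zero]
  refine ⟨-(T ((v * v) z)), ?_⟩
  rw [← hz]
  simp [hF, hG, sub_mul]
  abel

/-- An operator whose range has finite codimension is bounded below on the orthogonal complement
of its kernel. -/
theorem exists_norm_le_mul_norm_of_coFG_range {T : H →L[ℂ] H} (h : T.range.CoFG) :
    ∃ c : ℝ≥0, ∀ y ∈ (T.ker)ᗮ, ‖y‖ ≤ c * ‖T y‖ := by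
  have : CompleteSpace T.ker := T.isClosed_ker.completeSpace_coe
  set f : (T.ker)ᗮ →L[ℂ] H := T.comp (T.ker)ᗮ.subtypeL with hf
  have hinj : Function.Injective f := by
    rw [← f.coe_coe, ← LinearMap.ker_eq_bot, LinearMap.ker_eq_bot']
    intro y hy
    have h1 : (y : H) ∈ T.ker := hy
    have h2 := Submodule.inner_right_of_mem_orthogonal h1 y.2
    exact Subtype.ext (inner_self_eq_zero.1 h2)
  have hrange : f.range = T.range := by
    refine le_antisymm ?_ ?_
    · rintro _ ⟨y, rfl⟩
      exact ⟨y, rfl⟩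
    · rintro _ ⟨y, rfl⟩
      obtain ⟨k, hk, w, hw, rfl⟩ := T.ker.exists_add_mem_mem_orthogonal y
      refine ⟨⟨w, hw⟩, ?_⟩
      have hk' : T k = 0 := hk
      simp [hf, hk']
  -- A finite-dimensional algebraic complement forces the range to be closed, and an injective
  -- operator with closed range is bounded below.
  obtain ⟨G, hG⟩ := f.range.exists_isCompl
  have hfd : FiniteDimensional ℂ G := by
    rw [hrange] at hG
    exact Module.Finite.equiv (Submodule.quotientEquivOfIsCompl _ _ hG)
  have hcl := f.closed_complemented_range_of_isCompl_of_ker_eq_bot G hG G.closed_of_finiteDimensional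
    (LinearMap.ker_eq_bot.2 hinj)
  obtain ⟨c, hc⟩ := f.antilipschitz_of_injective_of_isClosed_range hinj
    (by rwa [LinearMap.coe_range, ContinuousLinearMap.coe_coe] at hcl)
  refine ⟨c, fun y hy => ?_⟩
  have := hc.le_mul_dist ⟨y, hy⟩ 0
  simpa [dist_eq_norm, hf] using this

theorem norm_modulus_apply (B : H →L[ℂ] H) (x : H) : ‖modulus B x‖ = ‖B x‖ := by
  have hs : star (modulus B) = modulus B := IsSelfAdjoint.of_nonneg (CFC.abs_nonneg B)
  have hm : modulus B * modulus B = star B * B := CFC.abs_mul_abs B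
  have h1 : ∀ S : H →L[ℂ] H, ⟪(star S * S) x, x⟫_ℂ = (‖S x‖ : ℂ) ^ 2 := fun S => by
    refine Eq.trans ?_ (inner_self_eq_norm_sq_to_K (𝕜 := ℂ) (S x))
    rw [ContinuousLinearMap.star_eq_adjoint, ← ContinuousLinearMap.adjoint_inner_left]
    rfl
  have h2 := h1 (modulus B)
  rw [hs, hm, h1 B] at h2
  have h3 : ‖B x‖ ^ 2 = ‖modulus B x‖ ^ 2 := by exact_mod_cast h2
  exact ((sq_eq_sq₀ (norm_nonneg _) (norm_nonneg _)).1 h3).symm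

theorem le_star_mul_self_of_norm_le {B : H →L[ℂ] H} {m : ℝ} (hm : 0 ≤ m)
    (h : ∀ x, m * ‖x‖ ≤ ‖B x‖) : algebraMap ℝ (H →L[ℂ] H) (m ^ 2) ≤ star B * B := by
  rw [ContinuousLinearMap.le_def, ContinuousLinearMap.isPositive_def']
  refine ⟨(IsSelfAdjoint.star_mul_self B).sub (IsSelfAdjoint.algebraMap _ (.all _)), fun x => ?_⟩
  have e : ⟪(star B * B) x, x⟫_ℂ = ⟪B x, B x⟫_ℂ := by
    rw [ContinuousLinearMap.star_eq_adjoint, ← ContinuousLinearMap.adjoint_inner_left]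
    rfl
  rw [ContinuousLinearMap.reApplyInnerSelf_apply, sub_apply, inner_sub_left, e, map_sub, inner_self_eq_norm_sq, Algebra.algebraMap_eq_smul_one]
  have e2 : RCLike.re ⟪((m ^ 2) • (1 : H →L[ℂ] H)) x, x⟫_ℂ = m ^ 2 * ‖x‖ ^ 2 := by
    rw [← inner_self_eq_norm_sq (𝕜 := ℂ) x]
    simp [← Complex.ofReal_pow]
  rw [e2]
  have := h x
  have h0 : 0 ≤ m * ‖x‖ := by positivity
  nlinarith

theorem isStrictlyPositive_of_algebraMap_le {a : H →L[ℂ] H} {m : ℝ} (hm : 0 < m)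
    (h : algebraMap ℝ (H →L[ℂ] H) m ≤ a) :
    IsStrictlyPositive a ∧ ‖a ^ (-1 : ℝ)‖ ≤ m⁻¹ := by
  have hpos : IsStrictlyPositive (algebraMap ℝ (H →L[ℂ] H) m) := by
    rw [IsStrictlyPositive.iff_of_unital]
    exact ⟨algebraMap_nonneg _ hm.le, (hm.ne'.isUnit).map _⟩
  refine ⟨hpos.of_le h, ?_⟩
  rw [CStarAlgebra.norm_le_iff_le_algebraMap _ (by positivity) CFC.rpow_nonneg]
  refine (CStarAlgebra.rpow_neg_one_le_rpow_neg_one h hpos).trans_eq ?_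
  lift m to ℝ≥0 using hm.le
  have := CFC.rpow_algebraMap (A := H →L[ℂ] H) (x := m) (y := -1)
  rw [NNReal.rpow_neg_one] at this
  exact this

theorem isUnit_modulus {B : H →L[ℂ] H} {c : ℝ} (hc : 0 < c)
    (h : ∀ x, ‖x‖ ≤ c * ‖B x‖) : IsUnit (modulus B) := by
  have h1 := le_star_mul_self_of_norm_le (B := B) (m := c⁻¹) (by positivity) fun x => by
    rw [inv_mul_le_iff₀ hc]; exact h x
  have h2 := (isStrictlyPositive_of_algebraMap_le (by positivity) h1).1.isUnit
  have hm : modulus B * modulus B = star B * B := CFC.abs_mul_abs B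
  rw [← hm] at h2
  exact ((Commute.refl (modulus B)).isUnit_mul_iff.1 h2).1

/-- The norm bounds on the inverses of the moduli give a uniform lower bound on the orthogonal
complements of the kernels. -/
theorem exists_uniform_lower_bound {p : ℝ} (hp : 0 < p) {T : H →L[ℂ] H} {Tn : ℕ → H →L[ℂ] H}
    (hν : Tendsto (fun n => ‖(Tn n - T) * T‖) atTop (𝓝 0)) (hT : T.IsFredholm)
    (hTn : ∀ n, IsPHyponormal p (Tn n))
    (hB : ∃ M : ℝ, ∀ n, IsUnit (modulus ((hTn n).orthKerPart hp)) →
      ‖Ring.inverse (modulus ((hTn n).orthKerPart hp))‖ ≤ M) :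
    ∃ M : ℝ, 1 ≤ M ∧ ∀ᶠ n in atTop, ∀ y ∈ ((Tn n).ker)ᗮ, ‖y‖ ≤ M * ‖Tn n y‖ := by
  obtain ⟨M, hM⟩ := hB
  refine ⟨max 1 M, le_max_left _ _, ?_⟩
  filter_upwards [eventually_coFG_range hT hν] with n hn y hy
  obtain ⟨c, hc⟩ := exists_norm_le_mul_norm_of_coFG_range hn
  set B := (hTn n).orthKerPart hp
  have hBx : ∀ x, ‖B x‖ = ‖Tn n x‖ := fun x => rfl
  -- The constant `c` depends on `n` and serves only for invertibility; uniformity comes from `M`.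
  have hu : IsUnit (modulus B) := by
    refine isUnit_modulus (c := c + 1) (by positivity) fun x => ?_
    rw [hBx]
    refine (hc x x.2).trans ?_
    gcongr
    simp
  set x : ((Tn n).ker)ᗮ := ⟨y, hy⟩
  have h1 : Ring.inverse (modulus B) (modulus B x) = x :=
    congrArg (fun f : ((Tn n).ker)ᗮ →L[ℂ] ((Tn n).ker)ᗮ => f x) (Ring.inverse_mul_cancel _ hu)
  calc ‖y‖ = ‖Ring.inverse (modulus B) (modulus B x)‖ := by rw [h1]; rfl
    _ ≤ ‖Ring.inverse (modulus B)‖ * ‖modulus B x‖ := ContinuousLinearMap.le_opNorm _ _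
    _ ≤ max 1 M * ‖modulus B x‖ := by gcongr; exact (hM n hu).trans (le_max_right _ _)
    _ = max 1 M * ‖Tn n y‖ := by rw [norm_modulus_apply, hBx]

end Fredholm

/-! ### Shifting the kernel and bounding the resolvent -/

section KernelPerturbation

theorem add_smul_pow_of_mul_eq_zero {A : Type*} [Ring A] [Algebra ℝ A] {b e : A}
    (he : e * e = e) (hbe : b * e = 0) (heb : e * b = 0) (s : ℝ) (n : ℕ) :
    (b + s • e) ^ (n + 1) = b ^ (n + 1) + s ^ (n + 1) • e := by
  induction n with
  | zero => simp
  | succ n ih =>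
    have h1 : b ^ (n + 1) * e = 0 := by rw [pow_succ, mul_assoc, hbe, mul_zero]
    rw [pow_succ, ih, add_mul, mul_add, mul_add, smul_mul_smul_comm, he, mul_smul_comm, h1,
      smul_mul_assoc, heb, ← pow_succ, ← pow_succ]
    simp

variable {H : Type*} [NormedAddCommGroup H] [InnerProductSpace ℂ H] [CompleteSpace H]

/-- The summands annihilate each other, so powers act separately on them; positive `n`-th roots are
unique. -/
theorem add_smul_rpow_inv_nat {a e : H →L[ℂ] H} (ha : 0 ≤ a) (he0 : 0 ≤ e) (he : e * e = e)
    (hae : a * e = 0) {t : ℝ} (ht : 0 ≤ t) {n : ℕ} (hn : n ≠ 0) :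
    (a + t • e) ^ ((n : ℝ)⁻¹) = a ^ ((n : ℝ)⁻¹) + t ^ ((n : ℝ)⁻¹) • e := by
  obtain ⟨m, rfl⟩ := Nat.exists_eq_succ_of_ne_zero hn
  rw [Nat.succ_eq_add_one]
  set q : ℝ := ((m + 1 : ℕ) : ℝ)⁻¹ with hq
  have hq0 : 0 < q := by positivity
  have hqn : q * ((m + 1 : ℕ) : ℝ) = 1 := inv_mul_cancel₀ (by positivity)
  have hb0 : 0 ≤ a ^ q := CFC.rpow_nonneg
  have hbe : a ^ q * e = 0 := by
    ext x
    exact rpow_apply_eq_zero ha hq0 (congrArg (fun f : H →L[ℂ] H => f x) hae)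
  have heb : e * a ^ q = 0 := by
    have h1 := congrArg star hbe
    rwa [star_mul, star_zero, (IsSelfAdjoint.of_nonneg hb0).star_eq,
      (IsSelfAdjoint.of_nonneg he0).star_eq] at h1
  have h1 := add_smul_pow_of_mul_eq_zero he hbe heb (t ^ q) m
  have h2 : (a ^ q) ^ (m + 1) = a := by
    rw [← CFC.rpow_natCast _ _ hb0, CFC.rpow_rpow_of_exponent_nonneg _ _ _ hq0.le (by positivity) ha,
      hqn, CFC.rpow_one _ ha]
  have h3 : (t ^ q) ^ (m + 1) = t := Real.rpow_inv_natCast_pow ht (by omega)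
  rw [h2, h3] at h1
  have hpos : 0 ≤ a ^ q + t ^ q • e :=
    add_nonneg hb0 (smul_nonneg (Real.rpow_nonneg ht q) he0)
  rw [← h1, ← CFC.rpow_natCast _ _ hpos,
    CFC.rpow_rpow_of_exponent_nonneg _ _ _ (by positivity) hq0.le hpos, mul_comm, hqn,
    CFC.rpow_one _ hpos]

/-- Löwner–Heinz with exponent `q / p ≤ 1`; it allows `p` to be lowered to some `2⁻ᵏ`. -/
theorem IsPHyponormal.rpow_le_rpow {p q : ℝ} (hq : 0 ≤ q) (hp : 0 < p) (hqp : q ≤ p)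
    {A : H →L[ℂ] H} (hA : IsPHyponormal p A) : (A * star A) ^ q ≤ (star A * A) ^ q := by
  have h := CFC.rpow_le_rpow (p := q / p) ⟨by positivity, (div_le_one hp).2 hqp⟩
    (sub_nonneg.1 hA)
  rwa [CFC.rpow_rpow_of_exponent_nonneg _ _ _ hp.le (by positivity) (mul_star_self_nonneg A),
    CFC.rpow_rpow_of_exponent_nonneg _ _ _ hp.le (by positivity) (star_mul_self_nonneg A),
    mul_div_cancel₀ _ hp.ne'] at h

/-- The kernel projection of a `p`-hyponormal operator annihilates it on both sides. -/
theorem IsPHyponormal.exists_ker_projection {p : ℝ} (hp : 0 < p) {A : H →L[ℂ] H}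
    (hA : IsPHyponormal p A) : ∃ E : H →L[ℂ] H, star E = E ∧ E * E = E ∧ A * E = 0 ∧ E * A = 0 ∧
      ‖E‖ ≤ 1 ∧ ∀ x, x - E x ∈ (A.ker)ᗮ := by
  have : CompleteSpace A.ker := A.isClosed_ker.completeSpace_coe
  set E : H →L[ℂ] H := (A.ker).starProjection with hE
  have hmem : ∀ x, E x ∈ A.ker := fun x => Submodule.starProjection_apply_mem _ x
  have hs : star E = E := isSelfAdjoint_starProjection A.ker
  have h1 : A * E = 0 := by ext x; exact hmem x
  have h2 : star A * E = 0 := by ext x; exact hA.star_apply_eq_zero hp (hmem x)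
  refine ⟨E, hs, Submodule.isIdempotentElem_starProjection A.ker, h1, ?_,
    Submodule.starProjection_norm_le _, fun x => Submodule.sub_starProjection_mem_orthogonal x⟩
  have h3 := congrArg star h2
  rwa [star_mul, star_star, star_zero, hs] at h3

/-- Spectrum is invariant under similarity. -/
theorem mem_spectrum_of_similar {R : Type*} [Ring R] [Algebra ℂ R] {s t b c : R} (hst : s * t = 1)
    (hts : t * s = 1) (hb : b = t * c * s) {z : ℂ} (hz : z ∈ spectrum ℂ c) : z ∈ spectrum ℂ b := by
  contrapose! hz
  rw [spectrum.notMem_iff] at hz ⊢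
  have hs : IsUnit s := isUnit_iff_exists_and_exists.2 ⟨⟨t, hst⟩, ⟨t, hts⟩⟩
  have ht : IsUnit t := isUnit_iff_exists_and_exists.2 ⟨⟨s, hts⟩, ⟨s, hst⟩⟩
  have e : algebraMap ℂ R z - c = s * (algebraMap ℂ R z - b) * t := by
    rw [hb, mul_sub, sub_mul, ← Algebra.commutes, mul_assoc _ s, hst, mul_one]
    congr 1
    calc c = (s * t) * c * (s * t) := by rw [hst, one_mul, mul_one]
      _ = _ := by simp only [mul_assoc]
  rw [e]
  exact (hs.mul hz).mul ht

/-- For uniformly bounded `p`-hyponormal operators that are uniformly bounded below on the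
orthogonal complement of the kernel, the resolvent at `l ≠ 0` is bounded in terms of the distance
from `l` to the spectrum. -/
theorem exists_resolvent_bound {p : ℝ} (hp : 0 < p) {K M : ℝ} (hK : 1 ≤ K) (hM : 1 ≤ M) {l : ℂ}
    (hl : l ≠ 0) {ε : ℝ} (hε : 0 < ε) (hεl : ε ≤ ‖l‖) :
    ∃ R : ℝ, ∀ A : H →L[ℂ] H, IsPHyponormal p A → ‖A‖ ≤ K →
      (∀ y ∈ (A.ker)ᗮ, ‖y‖ ≤ M * ‖A y‖) → (∀ z ∈ spectrum ℂ A, ε ≤ dist z l) →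
      ∃ r : H →L[ℂ] H, r * (algebraMap ℂ _ l - A) = 1 ∧ (algebraMap ℂ _ l - A) * r = 1 ∧
        ‖r‖ ≤ R := by
  obtain ⟨k, hk⟩ := exists_pow_lt_of_lt_one hp (one_half_lt_one (α := ℝ))
  have hkp : (((2 ^ k : ℕ) : ℝ)⁻¹) ≤ p := by
    refine le_trans (le_of_eq ?_) hk.le
    push_cast
    rw [one_div, inv_pow]
  set c : ℂ := -l with hc
  have hc0 : c ≠ 0 := neg_ne_zero.2 hl
  have hcpos : 0 < ‖c‖ := norm_pos_iff.2 hc0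
  -- Splitting `x` into `x - E x` and `E x` gives `‖x‖ ≤ N ‖b x‖`, hence `‖(b* b)⁻¹‖ ≤ N²`.
  set N : ℝ := M * 2 + ‖c‖⁻¹ with hN
  have hN0 : 1 ≤ N := by
    have : 0 < ‖c‖⁻¹ := by positivity
    linarith
  obtain ⟨D, hD⟩ := exists_similar_hyponormal (A := H →L[ℂ] H) k (K + ‖c‖) (N ^ 2)
    (by linarith) (one_le_pow₀ hN0)
  refine ⟨2 * (D * ε⁻¹ * D), fun A hA hAK hAM hAs => ?_⟩
  obtain ⟨E, hsE, hEE, hAE, hEA, hE1, hEx⟩ := hA.exists_ker_projection hp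
  have hE0 : 0 ≤ E := by
    have := star_mul_self_nonneg E
    rwa [hsE, hEE] at this
  have hAsE : star A * E = 0 := by
    have := congrArg star hEA
    rwa [star_mul, hsE, star_zero] at this
  have hEsA : E * star A = 0 := by
    have := congrArg star hAE
    rwa [star_mul, hsE, star_zero] at this
  set b := A + c • E with hb
  have hcc : star c * c = ((‖c‖ ^ 2 : ℝ) : ℂ) := by
    rw [Complex.star_def, ← Complex.normSq_eq_conj_mul_self, Complex.normSq_eq_norm_sq]
  have hbb : star b * b = star A * A + (‖c‖ ^ 2) • E := by
    rw [hb, star_add, star_smul, hsE, add_mul, mul_add, mul_add, mul_smul_comm, hAsE,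
      smul_mul_assoc, hEA, smul_mul_smul_comm, hEE, hcc, smul_zero, smul_zero, add_zero, zero_add]
    rfl
  have hbb' : b * star b = A * star A + (‖c‖ ^ 2) • E := by
    rw [hb, star_add, star_smul, hsE, add_mul, mul_add, mul_add, mul_smul_comm, hAE,
      smul_mul_assoc, hEsA, smul_mul_smul_comm, hEE, mul_comm c, hcc, smul_zero, smul_zero,
      add_zero, zero_add]
    rfl
  have hn : (2 ^ k : ℕ) ≠ 0 := by positivity
  have hhyp : (b * star b) ^ (((2 ^ k : ℕ) : ℝ)⁻¹) ≤ (star b * b) ^ (((2 ^ k : ℕ) : ℝ)⁻¹) := by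
    rw [hbb, hbb', add_smul_rpow_inv_nat (mul_star_self_nonneg A) hE0 hEE
        (by rw [mul_assoc, hAsE, mul_zero]) (by positivity) hn,
      add_smul_rpow_inv_nat (star_mul_self_nonneg A) hE0 hEE
        (by rw [mul_assoc, hAE, mul_zero]) (by positivity) hn]
    exact add_le_add_left (hA.rpow_le_rpow (by positivity) hp hkp) _
  have hbK : ‖b‖ ≤ K + ‖c‖ := by
    refine (norm_add_le _ _).trans (add_le_add hAK ?_)
    rw [norm_smul]
    exact mul_le_of_le_one_right (norm_nonneg _) hE1
  have hblow : ∀ x, N⁻¹ * ‖x‖ ≤ ‖b x‖ := by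
    intro x
    rw [inv_mul_le_iff₀ (by linarith)]
    have hEb : E (b x) = c • E x := by
      have h1 : E * b = c • E := by rw [hb, mul_add, hEA, zero_add, mul_smul_comm, hEE]
      exact congrArg (fun f : H →L[ℂ] H => f x) h1
    have hEn : ‖E (b x)‖ ≤ ‖b x‖ := (E.le_of_opNorm_le hE1 _).trans_eq (one_mul _)
    have h1 : ‖E x‖ ≤ ‖c‖⁻¹ * ‖b x‖ := by
      rw [hEb, norm_smul] at hEn
      rwa [le_inv_mul_iff₀ hcpos]
    have h2 : A x = b x - E (b x) := by rw [hEb, hb]; simp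
    have h3 : ‖x - E x‖ ≤ M * ‖A x‖ := by
      have h4 := hAM _ (hEx x)
      have h5 : A (E x) = 0 := congrArg (fun f : H →L[ℂ] H => f x) hAE
      rwa [map_sub, h5, sub_zero] at h4
    have h6 : ‖A x‖ ≤ 2 * ‖b x‖ := by
      rw [h2]
      exact (norm_sub_le _ _).trans (by linarith)
    calc ‖x‖ = ‖(x - E x) + E x‖ := by rw [sub_add_cancel]
      _ ≤ ‖x - E x‖ + ‖E x‖ := norm_add_le _ _
      _ ≤ M * (2 * ‖b x‖) + ‖c‖⁻¹ * ‖b x‖ :=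
        add_le_add (h3.trans (by gcongr)) h1
      _ = N * ‖b x‖ := by rw [hN]; ring
  obtain ⟨hpos, hinv⟩ := isStrictlyPositive_of_algebraMap_le (by positivity)
    (le_star_mul_self_of_norm_le (by positivity) hblow)
  rw [inv_pow, inv_inv] at hinv
  obtain ⟨s, t, C, hst, hts, hs, ht, hbC, hC⟩ := hD b hbK hpos hinv hhyp
  have hfac : ∀ z : ℂ, z ≠ 0 →
      algebraMap ℂ (H →L[ℂ] H) z - b = (algebraMap ℂ _ z - A) * (1 + (l / z) • E) := by
    intro z hz
    rw [mul_add, mul_one, mul_smul_comm, sub_mul, hAE, sub_zero, ← Algebra.smul_def, smul_smul,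
      div_mul_cancel₀ _ hz, hb, hc, neg_smul]
    abel
  have hCs : ∀ z ∈ spectrum ℂ C, ε ≤ dist z l := by
    intro z hz
    by_contra! hlt
    have hz0 : z ≠ 0 := by
      rintro rfl
      rw [dist_zero_left] at hlt
      linarith
    have hzA : z ∉ spectrum ℂ A := fun h => absurd (hAs z h) (not_le.2 hlt)
    -- The factor degenerates only at `z = -l`, whose distance `2‖l‖` from `l` exceeds `ε`.
    have hw : 1 + l / z ≠ 0 := by
      intro h
      have h1 : z = -l := by
        field_simp at h
        linear_combination h
      rw [h1, dist_eq_norm, ← neg_add', norm_neg, ← two_mul, norm_mul, Complex.norm_ofNat] at hlt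
      linarith
    have hunit : IsUnit (1 + (l / z) • E) := by
      set w := l / z
      have h1 : ∀ v : ℂ, (1 + w • E) * (1 - v • E) = 1 + (w - v - w * v) • E := by
        intro v
        rw [add_mul, one_mul, mul_sub, mul_one, smul_mul_smul_comm, hEE]
        module
      have h2 : ∀ v : ℂ, (1 - v • E) * (1 + w • E) = 1 + (w - v - w * v) • E := by
        intro v
        rw [sub_mul, one_mul, mul_add, mul_one, smul_mul_smul_comm, hEE]
        module
      have h3 : w - w / (1 + w) - w * (w / (1 + w)) = 0 := by field_simp; ring
      refine isUnit_iff_exists_and_exists.2 ⟨⟨1 - (w / (1 + w)) • E, ?_⟩, ⟨1 - (w / (1 + w)) • E, ?_⟩⟩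
      · rw [h1, h3, zero_smul, add_zero]
      · rw [h2, h3, zero_smul, add_zero]
    have hzb := mem_spectrum_of_similar hst hts hbC hz
    refine spectrum.notMem_iff.2 ?_ hzb
    rw [hfac z hz0]
    exact (spectrum.notMem_iff.1 hzA).mul hunit
  obtain ⟨Y, hY1, hY2, hYn⟩ := norm_resolvent_le_of_hyponormal hC hε hCs
  have hbl : algebraMap ℂ (H →L[ℂ] H) l - b = t * (algebraMap ℂ _ l - C) * s := by
    rw [hbC, mul_sub, sub_mul, ← Algebra.commutes, mul_assoc _ t, hts, mul_one]
  -- At `z = l` the factorization reads `l - b = (l - A)(1 + E)`; `‖1 + E‖ ≤ 2` explains the factor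
  -- 2 in the bound.
  have hright : (algebraMap ℂ (H →L[ℂ] H) l - A) * ((1 + E) * (t * Y * s)) = 1 := by
    have h1 := hfac l hl
    rw [div_self hl, one_smul] at h1
    rw [← mul_assoc, ← h1, hbl]
    calc t * (algebraMap ℂ _ l - C) * s * (t * Y * s)
        = t * ((algebraMap ℂ _ l - C) * ((s * t) * Y)) * s := by simp only [mul_assoc]
      _ = 1 := by rw [hst, one_mul, hY2, mul_one, hts]
  have hlA : l ∉ spectrum ℂ A := fun h => by
    have := hAs l h
    rw [dist_self] at this
    linarith
  have hu := spectrum.notMem_iff.1 hlA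
  refine ⟨(1 + E) * (t * Y * s), ?_, hright, ?_⟩
  · obtain ⟨u, hu⟩ := hu
    rw [← hu] at hright ⊢
    rw [← u.inv_eq_of_mul_eq_one_right hright, u.inv_mul]
  · have hD0 : 0 ≤ D := (norm_nonneg _).trans hs
    have h1 : ‖(1 : H →L[ℂ] H)‖ ≤ 1 := ContinuousLinearMap.norm_id_le
    refine (norm_mul_le _ _).trans (mul_le_mul ((norm_add_le _ _).trans (by linarith)) ?_
      (norm_nonneg _) (by norm_num))
    refine (norm_mul_le _ _).trans (mul_le_mul ((norm_mul_le _ _).trans ?_) hs (norm_nonneg _)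
      (by positivity))
    exact mul_le_mul ht hYn (norm_nonneg _) hD0

end KernelPerturbation

/-! ### Convergence of the spectra -/

/-- Under `ν`-convergence, the limit of non-invertible elements is non-invertible. -/
theorem NuConverges.zero_mem_spectrum {A : Type*} [NormedRing A] [NormedAlgebra ℂ A]
    [CompleteSpace A] {x : ℕ → A} {a : A} (h : NuConverges x a)
    (h0 : ∀ n, (0 : ℂ) ∈ spectrum ℂ (x n)) : (0 : ℂ) ∈ spectrum ℂ a := by
  by_contra hcon
  obtain ⟨u, hu⟩ := (spectrum.zero_notMem_iff ℂ).1 hcon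
  -- If `a` is invertible, `ν`-convergence becomes norm convergence, and the units are open.
  have hlim : Tendsto x atTop (𝓝 a) := by
    rw [tendsto_iff_norm_sub_tendsto_zero]
    refine squeeze_zero (fun _ => norm_nonneg _) (fun n => ?_)
      (by simpa using h.2.1.mul_const ‖((u⁻¹ : Aˣ) : A)‖)
    calc ‖x n - a‖ = ‖(x n - a) * a * ((u⁻¹ : Aˣ) : A)‖ := by
          rw [mul_assoc, ← hu, u.mul_inv, mul_one]
      _ ≤ _ := norm_mul_le _ _
  obtain ⟨n, hn⟩ := (hlim.eventually (hu ▸ Units.nhds u)).exists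
  exact (spectrum.zero_notMem_iff ℂ).2 hn (h0 n)

theorem mainTheorem4 {H : Type*} [NormedAddCommGroup H] [InnerProductSpace ℂ H] [CompleteSpace H]
    (p : ℝ) (hp : 0 < p) (T : H →L[ℂ] H) (Tn : ℕ → H →L[ℂ] H)
    (hν : NuConverges Tn T)
    (hT : T.IsFredholm)
    (hTn : ∀ n, IsPHyponormal p (Tn n))
    (h0 : ∀ n, Module.End.HasEigenvalue (Tn n : H →ₗ[ℂ] H) 0)
    (hB : ∃ M : ℝ, ∀ n, IsUnit (modulus ((hTn n).orthKerPart hp)) →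
      ‖Ring.inverse (modulus ((hTn n).orthKerPart hp))‖ ≤ M) :
    Tendsto (fun n => Metric.hausdorffEDist (spectrum ℂ (Tn n)) (spectrum ℂ T)) atTop (𝓝 0) := by
  have hz : ∀ n, (0 : ℂ) ∈ spectrum ℂ (Tn n) := by
    intro n
    rw [spectrum.zero_mem_iff]
    intro hu
    obtain ⟨v, hv⟩ := (h0 n).exists_hasEigenvector
    refine hv.2 ((ContinuousLinearMap.isUnit_iff_bijective.1 hu).1 ?_)
    rw [map_zero]
    simpa using hv.apply_eq_smul
  have hzT := hν.zero_mem_spectrum hz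
  obtain ⟨M, hM1, hM⟩ := exists_uniform_lower_bound hp hν.2.1 hT hTn hB
  obtain ⟨K, hK1, hK, -⟩ := hν.exists_bound
  have hpoint : ∀ l ∈ spectrum ℂ T, ∀ ε > 0, ∀ᶠ n in atTop,
      ∃ μ ∈ spectrum ℂ (Tn n), dist l μ < ε := by
    intro l hl ε hε
    rcases eq_or_ne l 0 with rfl | hl0
    · exact .of_forall fun n => ⟨0, hz n, by rwa [dist_self]⟩
    by_contra hcon
    obtain ⟨R, hR⟩ := exists_resolvent_bound (H := H) hp hK1 hM1 hl0
      (lt_min hε (norm_pos_iff.2 hl0)) (min_le_right ε ‖l‖)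
    refine hν.notMem_spectrum_of_frequently hl0 (M := R) ?_ hl
    refine ((not_eventually.1 hcon).and_eventually hM).mono fun n hn => ?_
    refine hR (Tn n) (hTn n) (hK n) hn.2 fun z hzn => ?_
    by_contra! hlt
    exact hn.1 ⟨z, hzn, by rw [dist_comm]; exact hlt.trans_le (min_le_left _ _)⟩
  have hlower : ∀ ε > 0, ∀ᶠ n in atTop, ∀ l ∈ spectrum ℂ T,
      ∃ μ ∈ spectrum ℂ (Tn n), dist l μ < ε := by
    intro ε hε
    -- Approximation within `ε / 2` at `l` serves all points within `ε / 2` of `l`; compactness of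
    -- `σ(T)` then makes it uniform.
    have hmem : {q : ℕ × ℂ | ∃ μ ∈ spectrum ℂ (Tn q.1), dist q.2 μ < ε} ∈
        (atTop : Filter ℕ) ×ˢ 𝓝ˢ (spectrum ℂ T) := by
      refine (spectrum.isCompact T).mem_prod_nhdsSet_of_forall fun l hl => ?_
      filter_upwards [(hpoint l hl (ε / 2) (half_pos hε)).prod_mk
        (Metric.ball_mem_nhds l (half_pos hε))] with q hq
      obtain ⟨μ, hμ, hd⟩ := hq.1
      refine ⟨μ, hμ, (dist_triangle q.2 l μ).trans_lt ?_⟩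
      have := Metric.mem_ball.1 hq.2
      linarith
    exact (Filter.Eventually.curry hmem).mono fun n hn => hn.self_of_nhdsSet
  rw [ENNReal.tendsto_nhds_zero]
  intro ε hε
  obtain ⟨δ, hδ0, hδε⟩ := ENNReal.lt_iff_exists_real_btwn.1 hε
  have hδ : 0 < δ := ENNReal.ofReal_pos.1 hδε.1
  filter_upwards [hlower δ hδ, hν.eventually_spectrum_near hzT hδ] with n h1 h2
  refine (Metric.hausdorffEDist_le_of_mem_edist (fun μ hμ => ?_) fun l hl => ?_).trans hδε.2.le
  · obtain ⟨l, hl, hd⟩ := h2 μ hμ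
    exact ⟨l, hl, by rw [edist_dist]; exact ENNReal.ofReal_le_ofReal hd.le⟩
  · obtain ⟨μ, hμ, hd⟩ := h1 l hl
    exact ⟨μ, hμ, by rw [edist_dist]; exact ENNReal.ofReal_le_ofReal hd.le⟩
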